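/- **Setting.** Let $P_{\theta}$, $\theta\in\mathcal T\subset\mathbb R^{d}$, be distributions on $\mathbb R^{p}$ with probability densities $f(y\mid\theta)$ with respect to a $\sigma$-finite measure, let $\theta_0$ be an interior point of $\mathcal T$, and let $y_1,y_2,\dots$ be i.i.d. from $P_{\theta_0}$. Let $\eta\in\mathbb R^{d_\eta}$ and $\zeta\in\mathbb R^{d_\zeta}$ be two non-overlapping sub-vectors of $\theta$ with true values $\eta_0,\zeta_0$. Let $f_1(y\mid\zeta)\ge 0$, for $\zeta$ in a domain $Z\subset\mathbb R^{d_\zeta}$, and $f_2(y\mid\eta,\zeta)\ge 0$, for $(\eta,\zeta)$ in a domain $W\subset\mathbb R^{d_\eta+d_\zeta}$, be measurable pseudo densities (they need not integrate to one), where $Z$ and $W$ are measurable and contain the corresponding sub-vectors of every $\theta\in\mathcal T$. **Regularity conditions.** For a pseudo density $h(y\mid z)$, $z\in D$, with true value $z_0$, write $\ell(z,y)=\log h(y\mid z)$ and $S_n(z)=\sum_{i=1}^n\ell(z,y_i)$. The conditions are: 1. The set $\{y:h(y\mid z)>0\}$ is the same for all $z\in D$, and it has $P_{\theta_0}$-probability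 one. 2. For some $\delta>0$, for $P_{\theta_0}$-almost every $y$, $\ell(\cdot,y)$ is three times differentiable on the ball $\mathcal B(z_0,\delta)$; the expectations $\mathbb E_{\theta_0}\nabla\ell(z,y)$ and $\mathbb E_{\theta_0}\nabla^2\ell(z,y)$ are finite for $z\in\mathcal B(z_0,\delta)$; and for every multi-index $\alpha$ with $|\alpha|=3$ there is $M_\alpha$ with $\mathbb E_{\theta_0}M_\alpha(y)<\infty$ and $\sup_{z\in\mathcal B(z_0,\delta)}|\partial^\alpha\ell(z,y)|\le M_\alpha(y)$ for $P_{\theta_0}$-almost every $y$. 3. $\mathbb E_{\theta_0}\nabla\ell(z_0,y)=0$, $\mathbb E_{\theta_0}\nabla^2\ell(z_0,y)=-\mathbb E_{\theta_0}[\nabla\ell(z_0,y)\nabla\ell(z_0,y)^{\top}]$, and $-\mathbb E_{\theta_0}\nabla^2\ell(z_0,y)$ is positive definite. 4. For every $\delta>0$ there is $\epsilon>0$ such that with probability one $\sup_{z\in D\setminus\mathcal B(z_0,\delta)}\frac1n[S_n(z)-S_n(z_0)]<-\epsilon$ for all sufficiently large $n$. 5. With probability one, for all large $n$ the function $S_n$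 has a maximizer $\hat z_n$ over $D$, and $\hat z_n\to z_0$. **Statement.** Assume that these conditions hold for $f_1$ (with $D=Z$, $z_0=\zeta_0$) and for $f_2$ (with $D=W$, $z_0=(\eta_0,\zeta_0)$). Let $\pi(\zeta)$ be a prior probability density on $Z$ that is continuous and positive at $\zeta_0$, and for each $\zeta\in Z$ let $\pi(\eta\mid\zeta)$ be a prior probability density on $\{\eta:(\eta,\zeta)\in W\}$, jointly measurable in $(\eta,\zeta)$, where $\pi(\eta\mid\zeta)$ is extended by $0$ outside $W$ and, as a function of $(\eta,\zeta)$, is continuous and positive at $(\eta_0,\zeta_0)$. Let $$\kappa_n(\zeta)\propto\exp\Big\{\sum_{i=1}^n\log f_1(y_i\mid\zeta)\Big\}\pi(\zeta),\qquad \tau_n(\eta\mid\zeta)\propto\exp\Big\{\sum_{i=1}^n\log f_2(y_i\mid\eta,\zeta)\Big\}\pi(\eta\mid\zeta),$$ normalized over $\zeta$, respectively over $\eta$ for each fixed $\zeta$. Then the Bayesian mosaic posterior $\tau_n(\eta\mid\zeta)\,\kappa_n(\zeta)$ is consistent at $(\eta_0,\zeta_0)$: with $P_{\theta_0}$-probability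 one, for every neighbourhood $U$ of $(\eta_0,\zeta_0)$, $$\lim_{n\to\infty}\int_U\tau_n(\eta\mid\zeta)\,\kappa_n(\zeta)\,d\eta\,d\zeta=1 .$$ -/

import Mathlib

open MeasureTheory ProbabilityTheory Filter Topology

noncomputable section

namespace BayesianMosaic

/-- A parametric family of probability densities `f θ`, for `θ` in the parameter space `T ⊆ ℝ^d`,
for `p`-dimensional data, with respect to a `σ`-finite reference measure `ν` (Lebesgue measure for
continuous data, counting measure on the integer points for count data, and so on). -/
structure DensityFamily (p d : ℕ) (T : Set (EuclideanSpace ℝ (Fin d)))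
    (ν : Measure (EuclideanSpace ℝ (Fin p)))
    (f : EuclideanSpace ℝ (Fin d) → EuclideanSpace ℝ (Fin p) → ℝ) : Prop where
  sigmaFinite : SigmaFinite ν
  measurable : ∀ θ ∈ T, Measurable (f θ)
  nonneg : ∀ θ ∈ T, ∀ y, 0 ≤ f θ y
  lintegral_eq_one : ∀ θ ∈ T, ∫⁻ y, ENNReal.ofReal (f θ y) ∂ν = 1

/-- The distribution `P_θ` with density `f θ` with respect to `ν`. -/
def dataLaw {p d : ℕ} (ν : Measure (EuclideanSpace ℝ (Fin p)))
    (f : EuclideanSpace ℝ (Fin d) → EuclideanSpace ℝ (Fin p) → ℝ)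
    (θ : EuclideanSpace ℝ (Fin d)) : Measure (EuclideanSpace ℝ (Fin p)) :=
  ν.withDensity (fun y => ENNReal.ofReal (f θ y))

/-- `y 0, y 1, …` are i.i.d. random vectors with common law `P`. -/
structure IsIIDSample {Ω : Type*} [MeasurableSpace Ω] (μ : Measure Ω) {p : ℕ}
    (P : Measure (EuclideanSpace ℝ (Fin p))) (y : ℕ → Ω → EuclideanSpace ℝ (Fin p)) : Prop where
  measurable : ∀ i, Measurable (y i)
  indep : iIndepFun y μ
  law : ∀ i, μ.map (y i) = P

/-- The sub-vector of `θ` with the coordinates listed by `e`. -/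
def subvec {d k : ℕ} (e : Fin k ↪ Fin d) (θ : EuclideanSpace ℝ (Fin d)) :
    EuclideanSpace ℝ (Fin k) :=
  WithLp.toLp 2 (fun i => θ (e i))

/-- The stacked vector `(η, ζ)`. -/
def stack {dη dζ : ℕ} (η : EuclideanSpace ℝ (Fin dη)) (ζ : EuclideanSpace ℝ (Fin dζ)) :
    EuclideanSpace ℝ (Fin dη ⊕ Fin dζ) :=
  WithLp.toLp 2 (Sum.elim (fun i => η i) (fun j => ζ j))

/-- The partial derivative `∂_{α 0} ⋯ ∂_{α (k-1)} g` at `z`. -/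
def partialDeriv {ι : Type*} [Fintype ι] [DecidableEq ι] {k : ℕ} (α : Fin k → ι)
    (g : EuclideanSpace ℝ ι → ℝ) (z : EuclideanSpace ℝ ι) : ℝ :=
  iteratedFDeriv ℝ k g z (fun j => EuclideanSpace.single (α j) (1 : ℝ))

/-- The log-likelihood `log h(y | z)` of one observation. -/
def logLik {Y E : Type*} (h : Y → E → ℝ) (y : Y) (z : E) : ℝ := Real.log (h y z)

/-- The log-likelihood `∑_{i=1}^n log h(y_i | z)` of the first `n` observations. -/
def sumLogLik {Ω Y E : Type*} (h : Y → E → ℝ) (y : ℕ → Ω → Y) (n : ℕ) (ω : Ω) (z : E) : ℝ :=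
  ∑ i ∈ Finset.range n, logLik h (y i ω) z

/-- `h(y | z)` is a pseudo density for parameters `z` in the domain `D`: it is nonnegative and
measurable, and need not integrate to one.  (Values at `z ∉ D` play no role.) -/
structure IsPseudoDensity {Y E : Type*} [MeasurableSpace Y] [MeasurableSpace E]
    (D : Set E) (h : Y → E → ℝ) : Prop where
  measurableSet : MeasurableSet D
  measurable : Measurable (fun q : Y × E => h q.1 q.2)
  nonneg : ∀ y, ∀ z ∈ D, 0 ≤ h y z

section Conditions

variable {Ω : Type*} [MeasurableSpace Ω] (μ : Measure Ω)
  {Y : Type*} [MeasurableSpace Y] (P : Measure Y) (y : ℕ → Ω → Y)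
  {ι : Type*} [Fintype ι] [DecidableEq ι]
  (D : Set (EuclideanSpace ℝ ι)) (z₀ : EuclideanSpace ℝ ι) (h : Y → EuclideanSpace ℝ ι → ℝ)

/-- The support `{y : h(y | z) > 0}` does not depend on `z ∈ D`; it carries the data distribution
`P`, so that the log-likelihood of the data is almost surely finite. -/
def CommonSupport : Prop :=
  (∀ z ∈ D, ∀ z' ∈ D, {x : Y | 0 < h x z} = {x : Y | 0 < h x z'}) ∧
    ∀ᵐ x ∂P, 0 < h x z₀

/-- Smoothness near `z₀`: three derivatives on a ball, finite expectations of the gradient and of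
the Hessian, and an integrable envelope for every third-order partial derivative. -/
def SmoothLogLik : Prop :=
  ∃ δ > 0,
    (∀ᵐ x ∂P, ∀ z ∈ Metric.ball z₀ δ, ∀ k < 3,
      DifferentiableAt ℝ (iteratedFDeriv ℝ k (logLik h x)) z) ∧
    (∀ z ∈ Metric.ball z₀ δ,
      (∀ i : ι, Integrable (fun x => partialDeriv ![i] (logLik h x) z) P) ∧
      ∀ i j : ι, Integrable (fun x => partialDeriv ![i, j] (logLik h x) z) P) ∧
    ∀ α : Fin 3 → ι, ∃ M : Y → ℝ, Integrable M P ∧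
      ∀ᵐ x ∂P, ∀ z ∈ Metric.ball z₀ δ, |partialDeriv α (logLik h x) z| ≤ M x

/-- The Fisher information `- E ∇² log h(y | z₀)`. -/
def fisherInfo : Matrix ι ι ℝ :=
  Matrix.of fun i j => - ∫ x, partialDeriv ![i, j] (logLik h x) z₀ ∂P

/-- The score has mean zero at `z₀`, the information identity holds, and the Fisher information is
positive definite. -/
def InformationIdentity : Prop :=
  (∀ i : ι, ∫ x, partialDeriv ![i] (logLik h x) z₀ ∂P = 0) ∧
    (∀ i j : ι,
      Integrable (fun x => partialDeriv ![i] (logLik h x) z₀ * partialDeriv ![j] (logLik h x) z₀) P ∧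
      ∫ x, partialDeriv ![i, j] (logLik h x) z₀ ∂P
        = - ∫ x, partialDeriv ![i] (logLik h x) z₀ * partialDeriv ![j] (logLik h x) z₀ ∂P) ∧
    (fisherInfo P z₀ h).PosDef

/-- Uniform separation of the log-likelihood away from `z₀`. -/
def SeparatedLogLik : Prop :=
  ∀ δ > 0, ∃ ε > 0, ∀ᵐ ω ∂μ, ∀ᶠ n : ℕ in atTop,
    ∀ z ∈ D, z ∉ Metric.ball z₀ δ →
      (1 / (n : ℝ)) * (sumLogLik h y n ω z - sumLogLik h y n ω z₀) < -ε

/-- Strong consistency of the maximum likelihood estimator: almost surely, `zhat n` is a maximizer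
over `D` of the log-likelihood for all large `n`, and it converges to `z₀`. -/
def ConsistentMLE : Prop :=
  ∃ zhat : ℕ → Ω → EuclideanSpace ℝ ι, ∀ᵐ ω ∂μ,
    (∀ᶠ n : ℕ in atTop, zhat n ω ∈ D ∧ IsMaxOn (sumLogLik h y n ω) D (zhat n ω)) ∧
    Tendsto (fun n => zhat n ω) atTop (𝓝 z₀)

/-- The five regularity conditions on a pseudo density. -/
structure RegularityConditions : Prop where
  commonSupport : CommonSupport P D z₀ h
  smooth : SmoothLogLik P z₀ h
  information : InformationIdentity P z₀ h
  separated : SeparatedLogLik μ y D z₀ h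
  consistentMLE : ConsistentMLE μ y D z₀ h

end Conditions

section Posterior

variable {Ω Y : Type*} {dη dζ : ℕ}

/-- `π(ζ)` is a probability density on the domain `Z`. -/
structure IsPriorDensity (Z : Set (EuclideanSpace ℝ (Fin dζ)))
    (π : EuclideanSpace ℝ (Fin dζ) → ℝ) : Prop where
  measurable : Measurable π
  nonneg : ∀ ζ, 0 ≤ π ζ
  eq_zero : ∀ ζ, ζ ∉ Z → π ζ = 0
  lintegral_eq_one : ∫⁻ ζ, ENNReal.ofReal (π ζ) = 1

/-- `π(η | ζ)`, written `π η ζ`, is for each `ζ ∈ Z` a probability density on the section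
`{η : (η, ζ) ∈ W}` of the domain `W`. -/
structure IsConditionalPriorDensity (Z : Set (EuclideanSpace ℝ (Fin dζ)))
    (W : Set (EuclideanSpace ℝ (Fin dη ⊕ Fin dζ)))
    (π : EuclideanSpace ℝ (Fin dη) → EuclideanSpace ℝ (Fin dζ) → ℝ) : Prop where
  measurable : Measurable
    (fun q : EuclideanSpace ℝ (Fin dη) × EuclideanSpace ℝ (Fin dζ) => π q.1 q.2)
  nonneg : ∀ η ζ, 0 ≤ π η ζ
  eq_zero : ∀ η ζ, stack η ζ ∉ W → π η ζ = 0
  lintegral_eq_one : ∀ ζ ∈ Z, ∫⁻ η, ENNReal.ofReal (π η ζ) = 1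

/-- `κ_n(ζ) ∝ exp (Q_n(ζ)) π(ζ)`, normalized over `ζ`. -/
def knotMarginal (f₁ : Y → EuclideanSpace ℝ (Fin dζ) → ℝ) (π₁ : EuclideanSpace ℝ (Fin dζ) → ℝ)
    (y : ℕ → Ω → Y) (n : ℕ) (ω : Ω) (ζ : EuclideanSpace ℝ (Fin dζ)) : ENNReal :=
  ENNReal.ofReal (Real.exp (sumLogLik f₁ y n ω ζ) * π₁ ζ) /
    ∫⁻ ζ', ENNReal.ofReal (Real.exp (sumLogLik f₁ y n ω ζ') * π₁ ζ')

/-- `τ_n(η | ζ) ∝ exp (L_n(η, ζ)) π(η | ζ)`, normalized over `η` for each `ζ`.  (A factor that does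
not depend on `η`, such as `exp (- max L_n)`, cancels in the normalization.) -/
def tileConditional (f₂ : Y → EuclideanSpace ℝ (Fin dη ⊕ Fin dζ) → ℝ)
    (π₂ : EuclideanSpace ℝ (Fin dη) → EuclideanSpace ℝ (Fin dζ) → ℝ)
    (y : ℕ → Ω → Y) (n : ℕ) (ω : Ω)
    (η : EuclideanSpace ℝ (Fin dη)) (ζ : EuclideanSpace ℝ (Fin dζ)) : ENNReal :=
  ENNReal.ofReal (Real.exp (sumLogLik f₂ y n ω (stack η ζ)) * π₂ η ζ) /
    ∫⁻ η', ENNReal.ofReal (Real.exp (sumLogLik f₂ y n ω (stack η' ζ)) * π₂ η' ζ)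

/-- The measure with Lebesgue density `τ_n(η | ζ) κ_n(ζ)`. -/
def mosaicPosterior (f₁ : Y → EuclideanSpace ℝ (Fin dζ) → ℝ)
    (π₁ : EuclideanSpace ℝ (Fin dζ) → ℝ)
    (f₂ : Y → EuclideanSpace ℝ (Fin dη ⊕ Fin dζ) → ℝ)
    (π₂ : EuclideanSpace ℝ (Fin dη) → EuclideanSpace ℝ (Fin dζ) → ℝ)
    (y : ℕ → Ω → Y) (n : ℕ) (ω : Ω) :
    Measure (EuclideanSpace ℝ (Fin dη) × EuclideanSpace ℝ (Fin dζ)) :=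
  volume.withDensity
    (fun q => tileConditional f₂ π₂ y n ω q.1 q.2 * knotMarginal f₁ π₁ y n ω q.2)

/-- Almost surely, the mass of every neighbourhood of `x₀` tends to one. -/
def ConsistentAt [MeasurableSpace Ω] (μ : Measure Ω) {X : Type*} [TopologicalSpace X]
    [MeasurableSpace X] (post : ℕ → Ω → Measure X) (x₀ : X) : Prop :=
  ∀ᵐ ω ∂μ, ∀ U ∈ 𝓝 x₀, Tendsto (fun n => post n ω U) atTop (𝓝 1)

end Posterior

end BayesianMosaic

end

/-! Along almost every data sequence each log-likelihood `S n` has two properties. Outside a ball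
around the true value `z₀` it lies below `S n z₀` by at least `n * ε`, by separation. On a small
enough ball it drops by at most `n * ε / 2`: integrable third-derivative envelopes make the
log-likelihood of one observation Lipschitz at `z₀` with an integrable constant, whose sample
averages converge by the strong law. `ConcentratesAt` records both, together with an upper bound for
`S n` (from the maximizer) that keeps normalizing integrals finite.

A prior bounded below near the true value then forces the normalized density to leave mass at most a
constant times `exp (-n * ε / 2)` outside the ball (`one_sub_le_setLIntegral_normalized`). For
`τ_n(· | ζ)` the comparison value is `S n` at `(η₀, ζ₀)`, not at the best `η` for the given `ζ`, so
one bound serves every `ζ ∈ Z` near `ζ₀`. By Tonelli, the mosaic mass of a product of balls is at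
least this uniform bound times the `κ_n`-mass near `ζ₀`; both factors tend to one. -/

namespace BayesianMosaic

/-! ### Mean value estimates for iterated derivatives. -/

section NormedSpace

variable {E : Type*} [NormedAddCommGroup E] [NormedSpace ℝ E]

theorem norm_iteratedFDeriv_sub_le {k : ℕ} {g : E → ℝ}
    {z₀ z : E} {δ C : ℝ}
    (hd : ∀ w ∈ Metric.ball z₀ δ, DifferentiableAt ℝ (iteratedFDeriv ℝ k g) w)
    (hC : ∀ w ∈ Metric.ball z₀ δ, ‖iteratedFDeriv ℝ (k + 1) g w‖ ≤ C)
    (hz : z ∈ Metric.ball z₀ δ) :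
    ‖iteratedFDeriv ℝ k g z - iteratedFDeriv ℝ k g z₀‖ ≤ C * ‖z - z₀‖ := by
  have hδ : 0 < δ := dist_nonneg.trans_lt (Metric.mem_ball.1 hz)
  refine (convex_ball z₀ δ).norm_image_sub_le_of_norm_fderiv_le hd (fun w hw => ?_)
    (Metric.mem_ball_self hδ) hz
  rw [norm_fderiv_iteratedFDeriv]
  exact hC w hw

theorem norm_iteratedFDeriv_le_add {k : ℕ} {g : E → ℝ}
    {z₀ z : E} {δ C : ℝ}
    (hd : ∀ w ∈ Metric.ball z₀ δ, DifferentiableAt ℝ (iteratedFDeriv ℝ k g) w)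
    (hC : ∀ w ∈ Metric.ball z₀ δ, ‖iteratedFDeriv ℝ (k + 1) g w‖ ≤ C)
    (hz : z ∈ Metric.ball z₀ δ) :
    ‖iteratedFDeriv ℝ k g z‖ ≤ ‖iteratedFDeriv ℝ k g z₀‖ + C * δ := by
  have h1 := norm_iteratedFDeriv_sub_le hd hC hz
  have h2 : ‖z - z₀‖ ≤ δ := by
    rw [← dist_eq_norm]
    exact (Metric.mem_ball.1 hz).le
  have h3 : 0 ≤ C := (norm_nonneg _).trans (hC z hz)
  have h4 := mul_le_mul_of_nonneg_left h2 h3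
  have h5 := norm_sub_norm_le (iteratedFDeriv ℝ k g z) (iteratedFDeriv ℝ k g z₀)
  linarith

end NormedSpace

/-! ### An integrable Lipschitz constant from the third-derivative envelopes. -/

section LocalEnvelope

variable {ι : Type*} [Fintype ι] [DecidableEq ι]

/-- Expand each argument in the standard basis; every coordinate is at most the Euclidean norm. -/
theorem norm_multilinear_le_sum_abs {k : ℕ}
    (m : ContinuousMultilinearMap ℝ (fun _ : Fin k => EuclideanSpace ℝ ι) ℝ) :
    ‖m‖ ≤ ∑ α : Fin k → ι, |m (fun j => EuclideanSpace.single (α j) (1 : ℝ))| := by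
  refine m.opNorm_le_bound (Finset.sum_nonneg fun _ _ => abs_nonneg _) fun v => ?_
  have hv : v = fun j => ∑ i : ι, v j i • EuclideanSpace.single i (1 : ℝ) := by
    funext j
    ext i
    simp [Finset.sum_apply, Pi.single_apply]
  have hexp : m v = ∑ α : Fin k → ι,
      (∏ j, v j (α j)) * m (fun j => EuclideanSpace.single (α j) (1 : ℝ)) := by
    conv_lhs => rw [hv]
    rw [ContinuousMultilinearMap.map_sum]
    refine Finset.sum_congr rfl fun α _ => ?_
    rw [ContinuousMultilinearMap.map_smul_univ, smul_eq_mul]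
  rw [hexp, Finset.sum_mul]
  refine (Finset.abs_sum_le_sum_abs _ _).trans (Finset.sum_le_sum fun α _ => ?_)
  rw [abs_mul, mul_comm]
  refine mul_le_mul_of_nonneg_left ?_ (abs_nonneg _)
  rw [Finset.abs_prod]
  exact Finset.prod_le_prod (fun _ _ => abs_nonneg _) fun j _ => PiLp.norm_apply_le (v j) (α j)

theorem norm_iteratedFDeriv_le_sum_abs_partialDeriv (k : ℕ) (g : EuclideanSpace ℝ ι → ℝ)
    (z : EuclideanSpace ℝ ι) :
    ‖iteratedFDeriv ℝ k g z‖ ≤ ∑ α : Fin k → ι, |partialDeriv α g z| :=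
  norm_multilinear_le_sum_abs _

/-- The third-order bound passes down through orders two, one and zero by repeated mean value
estimates, so the constant involves derivatives only at `z₀` and the envelopes `M`. -/
theorem abs_sub_le_of_partialDeriv_bound {g : EuclideanSpace ℝ ι → ℝ}
    {z₀ z : EuclideanSpace ℝ ι} {δ : ℝ} {M : (Fin 3 → ι) → ℝ}
    (hd : ∀ w ∈ Metric.ball z₀ δ, ∀ k < 3, DifferentiableAt ℝ (iteratedFDeriv ℝ k g) w)
    (hM : ∀ α, ∀ w ∈ Metric.ball z₀ δ, |partialDeriv α g w| ≤ M α)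
    (hz : z ∈ Metric.ball z₀ δ) :
    |g z - g z₀| ≤ ((∑ α : Fin 1 → ι, |partialDeriv α g z₀|) +
      ((∑ α : Fin 2 → ι, |partialDeriv α g z₀|) + (∑ α, M α) * δ) * δ) * ‖z - z₀‖ := by
  have hδ : 0 < δ := dist_nonneg.trans_lt (Metric.mem_ball.1 hz)
  have h3 : ∀ w ∈ Metric.ball z₀ δ, ‖iteratedFDeriv ℝ 3 g w‖ ≤ ∑ α, M α := fun w hw =>
    (norm_iteratedFDeriv_le_sum_abs_partialDeriv 3 g w).trans
      (Finset.sum_le_sum fun α _ => hM α w hw)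
  have h2 : ∀ w ∈ Metric.ball z₀ δ, ‖iteratedFDeriv ℝ 2 g w‖ ≤
      (∑ α : Fin 2 → ι, |partialDeriv α g z₀|) + (∑ α, M α) * δ := fun w hw =>
    (norm_iteratedFDeriv_le_add (fun u hu => hd u hu 2 (by norm_num)) h3 hw).trans
      (add_le_add_left (norm_iteratedFDeriv_le_sum_abs_partialDeriv 2 g z₀) _)
  have h1 : ∀ w ∈ Metric.ball z₀ δ, ‖iteratedFDeriv ℝ 1 g w‖ ≤
      (∑ α : Fin 1 → ι, |partialDeriv α g z₀|) +
      ((∑ α : Fin 2 → ι, |partialDeriv α g z₀|) + (∑ α, M α) * δ) * δ := fun w hw =>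
    (norm_iteratedFDeriv_le_add (fun u hu => hd u hu 1 (by norm_num)) h2 hw).trans
      (add_le_add_left (norm_iteratedFDeriv_le_sum_abs_partialDeriv 1 g z₀) _)
  have h0 := norm_iteratedFDeriv_sub_le (fun u hu => hd u hu 0 (by norm_num)) h1 hz
  -- A derivative of order zero is a map on the empty tuple, with value `g`; the product of norms is
  -- then empty, hence one.
  have happ := (iteratedFDeriv ℝ 0 g z - iteratedFDeriv ℝ 0 g z₀).le_opNorm
    (fun _ => (0 : EuclideanSpace ℝ ι))
  simp only [sub_apply, iteratedFDeriv_zero_apply, Real.norm_eq_abs,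
    Finset.univ_eq_empty, Finset.prod_empty, mul_one] at happ
  exact happ.trans h0

variable {Y : Type*} [MeasurableSpace Y] {P : Measure Y}
  {z₀ : EuclideanSpace ℝ ι} {h : Y → EuclideanSpace ℝ ι → ℝ}

/-- A smooth log-likelihood is Lipschitz at `z₀`, with an integrable Lipschitz constant. -/
theorem SmoothLogLik.exists_integrable_lipschitz (hs : SmoothLogLik P z₀ h) :
    ∃ δ > 0, ∃ K : Y → ℝ, Measurable K ∧ Integrable K P ∧
      ∀ᵐ x ∂P, ∀ z ∈ Metric.ball z₀ δ, |logLik h x z - logLik h x z₀| ≤ K x * ‖z - z₀‖ := by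
  obtain ⟨δ, hδ, hd, hint, henv⟩ := hs
  choose M hMint hM using henv
  obtain ⟨hi1, hi2⟩ := hint z₀ (Metric.mem_ball_self hδ)
  have hI1 : ∀ α : Fin 1 → ι, Integrable (fun x => partialDeriv α (logLik h x) z₀) P := by
    intro α
    have : α = ![α 0] := by
      ext j
      fin_cases j
      rfl
    rw [this]
    exact hi1 _
  have hI2 : ∀ α : Fin 2 → ι, Integrable (fun x => partialDeriv α (logLik h x) z₀) P := by
    intro α
    have : α = ![α 0, α 1] := by
      ext j
      fin_cases j <;> rfl
    rw [this]
    exact hi2 _ _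
  have hK : Integrable (fun x => (∑ α : Fin 1 → ι, |partialDeriv α (logLik h x) z₀|) +
      ((∑ α : Fin 2 → ι, |partialDeriv α (logLik h x) z₀|) + (∑ α, M α x) * δ) * δ) P :=
    (integrable_finsetSum _ fun α _ => (hI1 α).abs).add
      (((integrable_finsetSum _ fun α _ => (hI2 α).abs).add
        ((integrable_finsetSum _ fun α _ => hMint α).mul_const δ)).mul_const δ)
  -- A genuinely measurable version, so that composing it with the observations preserves
  -- independence and identical distribution.
  refine ⟨δ, hδ, hK.aestronglyMeasurable.mk _,
    hK.aestronglyMeasurable.stronglyMeasurable_mk.measurable,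
    hK.congr hK.aestronglyMeasurable.ae_eq_mk, ?_⟩
  filter_upwards [hd, ae_all_iff.2 hM, hK.aestronglyMeasurable.ae_eq_mk] with x hx hMx hKx z hz
  rw [← hKx]
  exact abs_sub_le_of_partialDeriv_bound hx hMx hz

end LocalEnvelope

/-! ### Almost sure properties and averages of the sample. -/

section Sample

variable {Ω : Type*} [MeasurableSpace Ω] {μ : Measure Ω} {p : ℕ}
  {P : Measure (EuclideanSpace ℝ (Fin p))} {y : ℕ → Ω → EuclideanSpace ℝ (Fin p)}

theorem IsIIDSample.ae_forall (hy : IsIIDSample μ P y) {q : EuclideanSpace ℝ (Fin p) → Prop}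
    (hq : ∀ᵐ x ∂P, q x) : ∀ᵐ ω ∂μ, ∀ i, q (y i ω) := by
  refine ae_all_iff.2 fun i => ?_
  rw [← hy.law i] at hq
  exact ae_of_ae_map (hy.measurable i).aemeasurable hq

theorem IsIIDSample.tendsto_average (hy : IsIIDSample μ P y)
    {K : EuclideanSpace ℝ (Fin p) → ℝ} (hKm : Measurable K) (hK : Integrable K P) :
    ∃ c, ∀ᵐ ω ∂μ,
      Tendsto (fun n : ℕ => (∑ i ∈ Finset.range n, K (y i ω)) / n) atTop (𝓝 c) := by
  refine ⟨_, strong_law_ae_real (fun i ω => K (y i ω)) ?_ ?_ ?_⟩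
  · rw [← hy.law 0] at hK
    exact hK.comp_measurable (hy.measurable 0)
  · intro i j hij
    exact (hy.indep.indepFun hij).comp hKm hKm
  · intro i
    have : IdentDistrib (y i) (y 0) μ μ :=
      ⟨(hy.measurable i).aemeasurable, (hy.measurable 0).aemeasurable,
        (hy.law i).trans (hy.law 0).symm⟩
    exact this.comp hKm

end Sample

/-- What posterior consistency needs of the log-likelihoods `S n` along one data sequence:
separation from `z₀`, boundedness above, and a local lower bound near `z₀`. -/
structure ConcentratesAt {E : Type*} [PseudoMetricSpace E] (D : Set E) (z₀ : E)
    (S : ℕ → E → ℝ) : Prop where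
  separated : ∀ δ > 0, ∃ ε > 0, ∀ᶠ n : ℕ in atTop, ∀ z ∈ D, z ∉ Metric.ball z₀ δ →
    S n z ≤ S n z₀ - n * ε
  bounded : ∀ᶠ n : ℕ in atTop, ∃ M, ∀ z ∈ D, S n z ≤ M
  lower : ∀ ε > 0, ∃ r > 0, ∀ᶠ n : ℕ in atTop, ∀ z ∈ Metric.ball z₀ r,
    S n z₀ - n * ε ≤ S n z

/-- The null set in the hypothesis depends on `δ`. Countably many radii `1 / (k + 1)` suffice, since
separation outside a smaller ball implies it outside a larger one. -/
theorem SeparatedLogLik.ae_forall {Ω : Type*} [MeasurableSpace Ω] {μ : Measure Ω}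
    {Y : Type*} {y : ℕ → Ω → Y} {ι : Type*} [Fintype ι]
    {D : Set (EuclideanSpace ℝ ι)} {z₀ : EuclideanSpace ℝ ι} {h : Y → EuclideanSpace ℝ ι → ℝ}
    (hs : SeparatedLogLik μ y D z₀ h) :
    ∀ᵐ ω ∂μ, ∀ δ > 0, ∃ ε > 0, ∀ᶠ n : ℕ in atTop, ∀ z ∈ D, z ∉ Metric.ball z₀ δ →
      sumLogLik h y n ω z ≤ sumLogLik h y n ω z₀ - n * ε := by
  have hk : ∀ k : ℕ, (0 : ℝ) < 1 / ((k : ℝ) + 1) := fun k => Nat.one_div_pos_of_nat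
  choose ε hε hae using fun k : ℕ => hs _ (hk k)
  filter_upwards [ae_all_iff.2 hae] with ω hω δ hδ
  obtain ⟨k, hkδ⟩ := exists_nat_one_div_lt hδ
  refine ⟨ε k, hε k, ?_⟩
  filter_upwards [hω k, eventually_gt_atTop 0] with n hn hn0 z hz hzb
  have hn' : (0 : ℝ) < n := Nat.cast_pos.2 hn0
  have := hn z hz fun hmem => hzb (Metric.ball_subset_ball hkδ.le hmem)
  rw [one_div, inv_mul_lt_iff₀ hn'] at this
  linarith

/-! ### From the regularity conditions to concentration along a data sequence. -/

section Regularity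

variable {Ω : Type*} [MeasurableSpace Ω] {μ : Measure Ω} {p : ℕ}
  {P : Measure (EuclideanSpace ℝ (Fin p))} {y : ℕ → Ω → EuclideanSpace ℝ (Fin p)}
  {ι : Type*} [Fintype ι] [DecidableEq ι]
  {D : Set (EuclideanSpace ℝ ι)} {z₀ : EuclideanSpace ℝ ι}
  {h : EuclideanSpace ℝ (Fin p) → EuclideanSpace ℝ ι → ℝ}

theorem ae_local_lower_bound (hy : IsIIDSample μ P y) (hs : SmoothLogLik P z₀ h) :
    ∀ᵐ ω ∂μ, ∀ ε > 0, ∃ r > 0, ∀ᶠ n : ℕ in atTop, ∀ z ∈ Metric.ball z₀ r,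
      sumLogLik h y n ω z₀ - n * ε ≤ sumLogLik h y n ω z := by
  obtain ⟨δ, hδ, K, hKm, hK, hlip⟩ := hs.exists_integrable_lipschitz
  obtain ⟨c, hc⟩ := hy.tendsto_average hKm hK
  filter_upwards [hc, hy.ae_forall hlip] with ω hω hl ε hε
  have hC : 0 < |c| + 1 := by positivity
  -- Averages of `K` are eventually below `|c| + 1`, so on this radius the mean loss is at most `ε`.
  refine ⟨min δ (ε / (|c| + 1)), lt_min hδ (div_pos hε hC), ?_⟩
  filter_upwards [hω.eventually_lt_const ((le_abs_self c).trans_lt (lt_add_one |c|)),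
    eventually_gt_atTop 0] with n hn hn0 z hz
  have hn' : (0 : ℝ) < n := Nat.cast_pos.2 hn0
  rw [div_lt_iff₀ hn'] at hn
  have hzd : ‖z - z₀‖ < min δ (ε / (|c| + 1)) := by
    rw [← dist_eq_norm]
    exact hz
  have hz1 : (|c| + 1) * ‖z - z₀‖ ≤ ε := by
    rw [mul_comm]
    exact (le_div_iff₀ hC).1 (hzd.trans_le (min_le_right _ _)).le
  have hsum : sumLogLik h y n ω z₀ - sumLogLik h y n ω z ≤
      (∑ i ∈ Finset.range n, K (y i ω)) * ‖z - z₀‖ := by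
    unfold sumLogLik
    rw [← Finset.sum_sub_distrib, Finset.sum_mul]
    refine Finset.sum_le_sum fun i _ => ?_
    have := hl i z (Metric.ball_subset_ball (min_le_left _ _) hz)
    linarith [neg_abs_le (logLik h (y i ω) z - logLik h (y i ω) z₀)]
  have h1 : (∑ i ∈ Finset.range n, K (y i ω)) * ‖z - z₀‖ ≤ n * ε := by
    calc _ ≤ ((|c| + 1) * n) * ‖z - z₀‖ := mul_le_mul_of_nonneg_right hn.le (norm_nonneg _)
      _ = n * ((|c| + 1) * ‖z - z₀‖) := by ring
      _ ≤ n * ε := mul_le_mul_of_nonneg_left hz1 hn'.le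
  linarith

theorem RegularityConditions.ae_concentratesAt (hy : IsIIDSample μ P y)
    (hreg : RegularityConditions μ P y D z₀ h) :
    ∀ᵐ ω ∂μ, ConcentratesAt D z₀ (fun n => sumLogLik h y n ω) := by
  obtain ⟨zhat, hz⟩ := hreg.consistentMLE
  filter_upwards [hz, ae_local_lower_bound hy hreg.smooth, hreg.separated.ae_forall]
    with ω h1 h2 h3
  exact ⟨h3, h1.1.mono fun n hn => ⟨_, fun z hzD => hn.2 hzD⟩, h2⟩

end Regularity

/-! ### Mass of normalized densities. -/

section Normalization

variable {X : Type*} [MeasurableSpace X] {ρ : Measure X} {F w : X → ℝ} {A B : Set X}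

/-- In `ENNReal` a quotient `a / a` is at most one even for `a = 0` or `a = ⊤`, so degenerate
normalizers need no exclusion. -/
theorem lintegral_normalized_le_one (g : X → ENNReal) (hg : Measurable g) :
    ∫⁻ x, g x / ∫⁻ x', g x' ∂ρ ∂ρ ≤ 1 := by
  simp only [div_eq_mul_inv]
  rw [lintegral_mul_const _ hg, ← div_eq_mul_inv]
  exact ENNReal.div_self_le_one

/-- If the log-likelihood `F` is at most `s - 2 e` off `A` and at least `s - e` on `B`, the
normalized density `exp F * w` puts almost all its mass on `A`. -/
theorem one_sub_le_setLIntegral_normalized (hF : Measurable F) (hw : Measurable w)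
    (hw1 : ∫⁻ x, ENNReal.ofReal (w x) ∂ρ ≤ 1) (hA : MeasurableSet A)
    {M s e c : ℝ} (hw0 : ∀ x, 0 ≤ w x) (hM : ∀ x, w x ≠ 0 → F x ≤ M)
    (hout : ∀ x, x ∉ A → w x ≠ 0 → F x ≤ s - 2 * e)
    (hin : ∀ x ∈ B, s - e ≤ F x ∧ c ≤ w x) (hc : 0 < c) (hρB : ρ B ≠ 0) :
    1 - ENNReal.ofReal (Real.exp (-e)) / (ENNReal.ofReal c * ρ B) ≤
      ∫⁻ x in A, ENNReal.ofReal (Real.exp (F x) * w x) /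
        (∫⁻ x', ENNReal.ofReal (Real.exp (F x') * w x') ∂ρ) ∂ρ := by
  set g : X → ENNReal := fun x => ENNReal.ofReal (Real.exp (F x) * w x) with hg
  have hgm : Measurable g := (hF.exp.mul hw).ennreal_ofReal
  -- Where the prior weight vanishes, `F` is uncontrolled but contributes nothing.
  have hbound : ∀ m : ℝ, ∀ x, (w x ≠ 0 → F x ≤ m) →
      g x ≤ ENNReal.ofReal (Real.exp m) * ENNReal.ofReal (w x) := by
    intro m x hx
    rw [← ENNReal.ofReal_mul (Real.exp_pos m).le]
    refine ENNReal.ofReal_le_ofReal ?_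
    rcases eq_or_ne (w x) 0 with h0 | h0
    · simp [h0]
    · exact mul_le_mul_of_nonneg_right (Real.exp_le_exp.2 (hx h0)) (hw0 x)
  have hupper : ∫⁻ x, g x ∂ρ ≤ ENNReal.ofReal (Real.exp M) := by
    calc ∫⁻ x, g x ∂ρ ≤ ∫⁻ x, ENNReal.ofReal (Real.exp M) * ENNReal.ofReal (w x) ∂ρ :=
          lintegral_mono fun x => hbound M x (hM x)
      _ = ENNReal.ofReal (Real.exp M) * ∫⁻ x, ENNReal.ofReal (w x) ∂ρ :=
          lintegral_const_mul _ hw.ennreal_ofReal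
      _ ≤ ENNReal.ofReal (Real.exp M) * 1 := by gcongr
      _ = _ := mul_one _
  have hlower : ENNReal.ofReal (Real.exp (s - e)) * (ENNReal.ofReal c * ρ B) ≤ ∫⁻ x, g x ∂ρ := by
    calc _ = ∫⁻ _ in B, ENNReal.ofReal (Real.exp (s - e)) * ENNReal.ofReal c ∂ρ := by
          rw [setLIntegral_const, mul_assoc]
      _ ≤ ∫⁻ x in B, g x ∂ρ := by
          refine setLIntegral_mono hgm fun x hx => ?_
          rw [← ENNReal.ofReal_mul (Real.exp_pos _).le]
          exact ENNReal.ofReal_le_ofReal (mul_le_mul (Real.exp_le_exp.2 (hin x hx).1)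
            (hin x hx).2 hc.le (Real.exp_pos _).le)
      _ ≤ _ := setLIntegral_le_lintegral _ _
  have htail : ∫⁻ x in Aᶜ, g x ∂ρ ≤ ENNReal.ofReal (Real.exp (s - 2 * e)) := by
    calc ∫⁻ x in Aᶜ, g x ∂ρ
        ≤ ∫⁻ x in Aᶜ, ENNReal.ofReal (Real.exp (s - 2 * e)) * ENNReal.ofReal (w x) ∂ρ :=
          setLIntegral_mono (hw.ennreal_ofReal.const_mul _)
            fun x hx => hbound _ x (hout x hx)
      _ ≤ ∫⁻ x, ENNReal.ofReal (Real.exp (s - 2 * e)) * ENNReal.ofReal (w x) ∂ρ :=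
          setLIntegral_le_lintegral _ _
      _ = ENNReal.ofReal (Real.exp (s - 2 * e)) * ∫⁻ x, ENNReal.ofReal (w x) ∂ρ :=
          lintegral_const_mul _ hw.ennreal_ofReal
      _ ≤ ENNReal.ofReal (Real.exp (s - 2 * e)) * 1 := by gcongr
      _ = _ := mul_one _
  have hcB : ENNReal.ofReal c * ρ B ≠ 0 :=
    mul_ne_zero (ENNReal.ofReal_pos.2 hc).ne' hρB
  have hexp : ENNReal.ofReal (Real.exp (s - e)) ≠ 0 := (ENNReal.ofReal_pos.2 (Real.exp_pos _)).ne'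
  set I := ∫⁻ x, g x ∂ρ with hI
  have hItop : I ≠ ⊤ := (hupper.trans_lt ENNReal.ofReal_lt_top).ne
  have hI0 : I ≠ 0 := fun h0 => mul_ne_zero hexp hcB (le_zero_iff.1 (h0 ▸ hlower))
  have htailI : (∫⁻ x in Aᶜ, g x ∂ρ) / I ≤
      ENNReal.ofReal (Real.exp (-e)) / (ENNReal.ofReal c * ρ B) := by
    calc _ ≤ ENNReal.ofReal (Real.exp (s - 2 * e)) /
          (ENNReal.ofReal (Real.exp (s - e)) * (ENNReal.ofReal c * ρ B)) :=
          ENNReal.div_le_div htail hlower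
      _ = _ := by
          -- The tail is at most `exp (s - 2 * e)` and the normalizer at least `exp (s - e)` times a
          -- constant; the quotient no longer depends on `s`.
          rw [show s - 2 * e = (s - e) + -e by ring, Real.exp_add,
            ENNReal.ofReal_mul (Real.exp_pos _).le]
          exact ENNReal.mul_div_mul_left _ _ hexp ENNReal.ofReal_ne_top
  have hsplit : (∫⁻ x in A, g x ∂ρ) / I + (∫⁻ x in Aᶜ, g x ∂ρ) / I = 1 := by
    rw [← ENNReal.add_div, lintegral_add_compl g hA]
    exact ENNReal.div_self hI0 hItop
  have hgoal : ∫⁻ x in A, g x / I ∂ρ = (∫⁻ x in A, g x ∂ρ) / I := by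
    simp only [div_eq_mul_inv]
    exact lintegral_mul_const _ hgm
  rw [hgoal, tsub_le_iff_right, ← hsplit]
  gcongr

theorem tendsto_one_sub_exp_div {ε : ℝ} (hε : 0 < ε) {b : ENNReal} (hb : b ≠ 0) :
    Tendsto (fun n : ℕ => 1 - ENNReal.ofReal (Real.exp (-(n * ε))) / b) atTop (𝓝 1) := by
  have h1 : Tendsto (fun n : ℕ => Real.exp (-(n * ε))) atTop (𝓝 0) :=
    Real.tendsto_exp_neg_atTop_nhds_zero.comp
      (tendsto_natCast_atTop_atTop.atTop_mul_const hε)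
  have h2 := ENNReal.Tendsto.div_const (ENNReal.tendsto_ofReal h1) (b := b) (Or.inr hb)
  have h3 := ENNReal.Tendsto.sub (tendsto_const_nhds (x := (1 : ENNReal))) h2
    (Or.inl ENNReal.one_ne_top)
  simpa using h3

end Normalization

/-! ### Geometry of the stacked parameter. -/

section Stack

variable {dη dζ : ℕ}

theorem continuous_stack : Continuous
    (fun q : EuclideanSpace ℝ (Fin dη) × EuclideanSpace ℝ (Fin dζ) => stack q.1 q.2) := by
  refine (PiLp.continuous_toLp 2 _).comp (continuous_pi fun i => ?_)
  rcases i with i | j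
  · simp only [Sum.elim_inl]
    fun_prop
  · simp only [Sum.elim_inr]
    fun_prop

/-- Lets separation be applied for any `ζ`: if `η` is outside the ball at `η₀`, the stacked vector
is outside the ball of equal radius. -/
theorem dist_le_dist_stack (η η' : EuclideanSpace ℝ (Fin dη)) (ζ ζ' : EuclideanSpace ℝ (Fin dζ)) :
    dist η η' ≤ dist (stack η ζ) (stack η' ζ') := by
  rw [EuclideanSpace.dist_eq, EuclideanSpace.dist_eq, Fintype.sum_sum_type]
  refine Real.sqrt_le_sqrt ?_
  simp only [stack, Sum.elim_inl]
  exact le_add_of_nonneg_right (Finset.sum_nonneg fun _ _ => sq_nonneg _)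

end Stack

theorem measurable_sumLogLik {Ω Y E : Type*} [MeasurableSpace Y] [MeasurableSpace E] {D : Set E}
    {h : Y → E → ℝ} (hh : IsPseudoDensity D h) (y : ℕ → Ω → Y) (n : ℕ) (ω : Ω) :
    Measurable (sumLogLik h y n ω) := by
  unfold sumLogLik logLik
  exact Finset.measurable_fun_sum _ fun i _ =>
    (hh.measurable.comp measurable_prodMk_left).log

theorem knotMarginal_eq_zero {Ω Y : Type*} {dζ : ℕ}
    {Z : Set (EuclideanSpace ℝ (Fin dζ))} {f₁ : Y → EuclideanSpace ℝ (Fin dζ) → ℝ}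
    {π₁ : EuclideanSpace ℝ (Fin dζ) → ℝ} {y : ℕ → Ω → Y} {ω : Ω} (hπ₁ : IsPriorDensity Z π₁) (n : ℕ)
    {ζ : EuclideanSpace ℝ (Fin dζ)} (hζ : ζ ∉ Z) : knotMarginal f₁ π₁ y n ω ζ = 0 := by
  simp [knotMarginal, hπ₁.eq_zero ζ hζ]

theorem measurable_section {X Y V : Type*} [MeasurableSpace X] [MeasurableSpace Y]
    [MeasurableSpace V] {g : X → Y → V} (hg : Measurable fun q : X × Y => g q.1 q.2) (y : Y) :
    Measurable fun x => g x y :=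
  hg.comp measurable_prodMk_right

/-! ### Concentration of the two factors and of their product. -/

section Mosaic

variable {Ω Y : Type*} [MeasurableSpace Y] {dη dζ : ℕ}
  {Z : Set (EuclideanSpace ℝ (Fin dζ))} {W : Set (EuclideanSpace ℝ (Fin dη ⊕ Fin dζ))}
  {f₁ : Y → EuclideanSpace ℝ (Fin dζ) → ℝ} {π₁ : EuclideanSpace ℝ (Fin dζ) → ℝ}
  {f₂ : Y → EuclideanSpace ℝ (Fin dη ⊕ Fin dζ) → ℝ}
  {π₂ : EuclideanSpace ℝ (Fin dη) → EuclideanSpace ℝ (Fin dζ) → ℝ}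
  {y : ℕ → Ω → Y} {ω : Ω} {η₀ : EuclideanSpace ℝ (Fin dη)} {ζ₀ : EuclideanSpace ℝ (Fin dζ)}

theorem measurable_knotMarginal (hf₁ : IsPseudoDensity Z f₁) (hπ₁ : IsPriorDensity Z π₁)
    (n : ℕ) : Measurable (knotMarginal f₁ π₁ y n ω) :=
  (((measurable_sumLogLik hf₁ y n ω).exp.mul hπ₁.measurable).ennreal_ofReal).div_const _

theorem measurable_tile_numerator (hf₂ : IsPseudoDensity W f₂)
    (hπ₂ : IsConditionalPriorDensity Z W π₂) (n : ℕ) :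
    Measurable (fun q : EuclideanSpace ℝ (Fin dη) × EuclideanSpace ℝ (Fin dζ) =>
      ENNReal.ofReal (Real.exp (sumLogLik f₂ y n ω (stack q.1 q.2)) * π₂ q.1 q.2)) :=
  ((((measurable_sumLogLik hf₂ y n ω).comp continuous_stack.measurable).exp).mul
    hπ₂.measurable).ennreal_ofReal

theorem measurable_tileConditional (hf₂ : IsPseudoDensity W f₂)
    (hπ₂ : IsConditionalPriorDensity Z W π₂) (n : ℕ) :
    Measurable (fun q : EuclideanSpace ℝ (Fin dη) × EuclideanSpace ℝ (Fin dζ) =>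
      tileConditional f₂ π₂ y n ω q.1 q.2) := by
  have hnum := measurable_tile_numerator (y := y) (ω := ω) hf₂ hπ₂ n
  exact hnum.div ((hnum.lintegral_prod_left').comp measurable_snd)

theorem lintegral_tileConditional_le_one (hf₂ : IsPseudoDensity W f₂)
    (hπ₂ : IsConditionalPriorDensity Z W π₂) (n : ℕ) (ζ : EuclideanSpace ℝ (Fin dζ)) :
    ∫⁻ η, tileConditional f₂ π₂ y n ω η ζ ≤ 1 := by
  have hnum : Measurable fun η =>
      ENNReal.ofReal (Real.exp (sumLogLik f₂ y n ω (stack η ζ)) * π₂ η ζ) :=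
    measurable_section (g := fun η ζ =>
      ENNReal.ofReal (Real.exp (sumLogLik f₂ y n ω (stack η ζ)) * π₂ η ζ))
      (measurable_tile_numerator hf₂ hπ₂ n) ζ
  unfold tileConditional
  exact lintegral_normalized_le_one _ hnum

theorem lintegral_knotMarginal_le_one (hf₁ : IsPseudoDensity Z f₁) (hπ₁ : IsPriorDensity Z π₁)
    (n : ℕ) : ∫⁻ ζ, knotMarginal f₁ π₁ y n ω ζ ≤ 1 := by
  unfold knotMarginal
  exact lintegral_normalized_le_one _
    ((measurable_sumLogLik hf₁ y n ω).exp.mul hπ₁.measurable).ennreal_ofReal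

theorem mosaicPosterior_prod (hf₁ : IsPseudoDensity Z f₁) (hπ₁ : IsPriorDensity Z π₁)
    (hf₂ : IsPseudoDensity W f₂) (hπ₂ : IsConditionalPriorDensity Z W π₂) (n : ℕ)
    {A : Set (EuclideanSpace ℝ (Fin dη))} {B : Set (EuclideanSpace ℝ (Fin dζ))}
    (hA : MeasurableSet A) (hB : MeasurableSet B) :
    mosaicPosterior f₁ π₁ f₂ π₂ y n ω (A ×ˢ B) =
      ∫⁻ ζ in B, (∫⁻ η in A, tileConditional f₂ π₂ y n ω η ζ) * knotMarginal f₁ π₁ y n ω ζ := by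
  have hτ := measurable_tileConditional (y := y) (ω := ω) hf₂ hπ₂ n
  have hκ := measurable_knotMarginal (y := y) (ω := ω) hf₁ hπ₁ n
  rw [mosaicPosterior, withDensity_apply _ (hA.prod hB), Measure.volume_eq_prod,
    ← Measure.prod_restrict, lintegral_prod_symm' (fun q => tileConditional f₂ π₂ y n ω q.1 q.2 *
      knotMarginal f₁ π₁ y n ω q.2) (hτ.mul (hκ.comp measurable_snd))]
  refine lintegral_congr fun ζ => ?_
  exact lintegral_mul_const (knotMarginal f₁ π₁ y n ω ζ)
    (f := fun η => tileConditional f₂ π₂ y n ω η ζ)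
    (measurable_section (g := tileConditional f₂ π₂ y n ω) hτ ζ)

theorem mosaicPosterior_le_one (hf₁ : IsPseudoDensity Z f₁) (hπ₁ : IsPriorDensity Z π₁)
    (hf₂ : IsPseudoDensity W f₂) (hπ₂ : IsConditionalPriorDensity Z W π₂) (n : ℕ)
    (U : Set (EuclideanSpace ℝ (Fin dη) × EuclideanSpace ℝ (Fin dζ))) :
    mosaicPosterior f₁ π₁ f₂ π₂ y n ω U ≤ 1 := by
  refine (measure_mono (Set.subset_univ U)).trans ?_
  rw [← Set.univ_prod_univ,
    mosaicPosterior_prod hf₁ hπ₁ hf₂ hπ₂ n MeasurableSet.univ MeasurableSet.univ]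
  simp only [Measure.restrict_univ]
  calc _ ≤ ∫⁻ ζ, 1 * knotMarginal f₁ π₁ y n ω ζ := lintegral_mono fun ζ =>
        mul_le_mul_left (lintegral_tileConditional_le_one hf₂ hπ₂ n ζ) _
    _ ≤ 1 := by
        simp only [one_mul]
        exact lintegral_knotMarginal_le_one hf₁ hπ₁ n

/-- The marginal `κ_n` concentrates at `ζ₀`. -/
theorem exists_knotMarginal_lower (hf₁ : IsPseudoDensity Z f₁) (hπ₁ : IsPriorDensity Z π₁)
    (hcont : ContinuousAt π₁ ζ₀) (hpos : 0 < π₁ ζ₀)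
    (hS : ConcentratesAt Z ζ₀ (fun n => sumLogLik f₁ y n ω)) {r : ℝ} (hr : 0 < r) :
    ∃ a : ℕ → ENNReal, Tendsto a atTop (𝓝 1) ∧ ∀ᶠ n in atTop,
      a n ≤ ∫⁻ ζ in Metric.ball ζ₀ r, knotMarginal f₁ π₁ y n ω ζ := by
  obtain ⟨ε, hε, hsep⟩ := hS.separated r hr
  -- Half the separation rate: the normalization bound applies with `e = n * (ε / 2)`.
  obtain ⟨r₁, hr₁, hlow⟩ := hS.lower (ε / 2) (half_pos hε)
  obtain ⟨r₂, hr₂, hπ⟩ := Metric.eventually_nhds_iff_ball.1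
    (hcont.eventually (lt_mem_nhds (half_lt_self hpos)))
  have hmin : 0 < min r₁ r₂ := lt_min hr₁ hr₂
  have hvol : volume (Metric.ball ζ₀ (min r₁ r₂)) ≠ 0 := (Metric.measure_ball_pos _ _ hmin).ne'
  refine ⟨_, tendsto_one_sub_exp_div (half_pos hε)
    (mul_ne_zero (ENNReal.ofReal_pos.2 (half_pos hpos)).ne' hvol), ?_⟩
  filter_upwards [hsep, hlow, hS.bounded] with n h1 h2 ⟨M, h3⟩
  have hmem : ∀ ζ, π₁ ζ ≠ 0 → ζ ∈ Z := fun ζ h => by_contra fun hn => h (hπ₁.eq_zero ζ hn)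
  refine one_sub_le_setLIntegral_normalized (s := sumLogLik f₁ y n ω ζ₀)
    (measurable_sumLogLik hf₁ y n ω) hπ₁.measurable hπ₁.lintegral_eq_one.le
    measurableSet_ball hπ₁.nonneg (fun ζ hζ => h3 ζ (hmem ζ hζ))
    (fun ζ hζ hw => ?_) (fun ζ hζ => ⟨?_, ?_⟩) (half_pos hpos) hvol
  · have := h1 ζ (hmem ζ hw) hζ
    linarith
  · exact h2 ζ (Metric.ball_subset_ball (min_le_left _ _) hζ)
  · exact (hπ ζ (Metric.ball_subset_ball (min_le_right _ _) hζ)).le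

/-- The conditionals `τ_n(· | ζ)` concentrate at `η₀`, uniformly for `ζ` near `ζ₀`. -/
theorem exists_tileConditional_lower (hf₂ : IsPseudoDensity W f₂)
    (hπ₂ : IsConditionalPriorDensity Z W π₂)
    (hcont : ContinuousAt
      (fun q : EuclideanSpace ℝ (Fin dη) × EuclideanSpace ℝ (Fin dζ) => π₂ q.1 q.2) (η₀, ζ₀))
    (hpos : 0 < π₂ η₀ ζ₀)
    (hS : ConcentratesAt W (stack η₀ ζ₀) (fun n => sumLogLik f₂ y n ω)) {δ : ℝ} (hδ : 0 < δ) :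
    ∃ r > 0, ∃ a : ℕ → ENNReal, Tendsto a atTop (𝓝 1) ∧ ∀ᶠ n in atTop,
      ∀ ζ ∈ Z, ζ ∈ Metric.ball ζ₀ r →
        a n ≤ ∫⁻ η in Metric.ball η₀ δ, tileConditional f₂ π₂ y n ω η ζ := by
  obtain ⟨ε, hε, hsep⟩ := hS.separated δ hδ
  obtain ⟨r₁, hr₁, hlow⟩ := hS.lower (ε / 2) (half_pos hε)
  have hstack : ∀ᶠ q : EuclideanSpace ℝ (Fin dη) × EuclideanSpace ℝ (Fin dζ) in 𝓝 (η₀, ζ₀),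
      stack q.1 q.2 ∈ Metric.ball (stack η₀ ζ₀) r₁ :=
    continuous_stack.continuousAt.eventually (Metric.ball_mem_nhds _ hr₁)
  -- Balls in the product are products of balls, so the same `η`-ball of radius `r` supports the
  -- lower bounds for all `ζ` within `r` of `ζ₀`.
  obtain ⟨r, hr, hball⟩ := Metric.eventually_nhds_iff_ball.1
    (hstack.and (hcont.eventually (lt_mem_nhds (half_lt_self hpos))))
  have hvol : volume (Metric.ball η₀ r) ≠ 0 := (Metric.measure_ball_pos _ _ hr).ne'
  refine ⟨r, hr, _, tendsto_one_sub_exp_div (half_pos hε)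
    (mul_ne_zero (ENNReal.ofReal_pos.2 (half_pos hpos)).ne' hvol), ?_⟩
  filter_upwards [hsep, hlow, hS.bounded] with n h1 h2 ⟨M, h3⟩ ζ hζZ hζ
  have hmem : ∀ η, π₂ η ζ ≠ 0 → stack η ζ ∈ W :=
    fun η h => by_contra fun hn => h (hπ₂.eq_zero η ζ hn)
  have hq : ∀ η ∈ Metric.ball η₀ r, (η, ζ) ∈ Metric.ball (η₀, ζ₀) r := fun η hη => by
    rw [← ball_prod_same]
    exact ⟨hη, hζ⟩
  refine one_sub_le_setLIntegral_normalized (s := sumLogLik f₂ y n ω (stack η₀ ζ₀))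
    (F := fun η => sumLogLik f₂ y n ω (stack η ζ)) (w := fun η => π₂ η ζ)
    ((measurable_sumLogLik hf₂ y n ω).comp
      (continuous_stack.measurable.comp measurable_prodMk_right))
    (hπ₂.measurable.comp measurable_prodMk_right) (hπ₂.lintegral_eq_one ζ hζZ).le
    measurableSet_ball (fun η => hπ₂.nonneg η ζ)
    (fun η hη => h3 _ (hmem η hη)) (fun η hη hw => ?_) (fun η hη => ⟨?_, ?_⟩)
    (half_pos hpos) hvol
  · have := h1 _ (hmem η hw) fun hb => hη ((dist_le_dist_stack η η₀ ζ ζ₀).trans_lt hb)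
    linarith
  · exact h2 _ (hball _ (hq η hη)).1
  · exact (hball _ (hq η hη)).2.le

/-- Consistency of the mosaic posterior along one data sequence. -/
theorem tendsto_mosaicPosterior (hf₁ : IsPseudoDensity Z f₁) (hπ₁ : IsPriorDensity Z π₁)
    (hf₂ : IsPseudoDensity W f₂) (hπ₂ : IsConditionalPriorDensity Z W π₂)
    (hcont₁ : ContinuousAt π₁ ζ₀) (hpos₁ : 0 < π₁ ζ₀)
    (hcont₂ : ContinuousAt
      (fun q : EuclideanSpace ℝ (Fin dη) × EuclideanSpace ℝ (Fin dζ) => π₂ q.1 q.2) (η₀, ζ₀))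
    (hpos₂ : 0 < π₂ η₀ ζ₀)
    (hS₁ : ConcentratesAt Z ζ₀ (fun n => sumLogLik f₁ y n ω))
    (hS₂ : ConcentratesAt W (stack η₀ ζ₀) (fun n => sumLogLik f₂ y n ω))
    {U : Set (EuclideanSpace ℝ (Fin dη) × EuclideanSpace ℝ (Fin dζ))} (hU : U ∈ 𝓝 (η₀, ζ₀)) :
    Tendsto (fun n => mosaicPosterior f₁ π₁ f₂ π₂ y n ω U) atTop (𝓝 1) := by
  obtain ⟨δ, hδ, hδU⟩ := Metric.mem_nhds_iff.1 hU
  obtain ⟨r, hr, a, ha, hτ⟩ := exists_tileConditional_lower hf₂ hπ₂ hcont₂ hpos₂ hS₂ hδ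
  obtain ⟨b, hb, hκ⟩ :=
    exists_knotMarginal_lower hf₁ hπ₁ hcont₁ hpos₁ hS₁ (lt_min hr hδ)
  have hab : Tendsto (fun n => a n * b n) atTop (𝓝 1) := by
    simpa using ENNReal.Tendsto.mul ha (Or.inl one_ne_zero) hb (Or.inl one_ne_zero)
  refine tendsto_of_tendsto_of_tendsto_of_le_of_le' hab tendsto_const_nhds ?_
    (Eventually.of_forall fun n => mosaicPosterior_le_one hf₁ hπ₁ hf₂ hπ₂ n U)
  filter_upwards [hτ, hκ] with n h1 h2
  have hsub : Metric.ball η₀ δ ×ˢ Metric.ball ζ₀ (min r δ) ⊆ U := by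
    refine (Set.prod_mono_right (Metric.ball_subset_ball (min_le_right _ _))).trans ?_
    rwa [ball_prod_same]
  refine le_trans ?_ (measure_mono hsub)
  rw [mosaicPosterior_prod hf₁ hπ₁ hf₂ hπ₂ n measurableSet_ball measurableSet_ball]
  have hκm := measurable_knotMarginal (y := y) (ω := ω) hf₁ hπ₁ n
  calc a n * b n
      ≤ a n * ∫⁻ ζ in Metric.ball ζ₀ (min r δ), knotMarginal f₁ π₁ y n ω ζ := by gcongr
    _ = ∫⁻ ζ in Metric.ball ζ₀ (min r δ), a n * knotMarginal f₁ π₁ y n ω ζ :=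
        (lintegral_const_mul _ hκm).symm
    _ ≤ _ := by
        refine setLIntegral_mono' measurableSet_ball fun ζ hζ => ?_
        -- The bound on `τ_n` is available only for `ζ ∈ Z`, where the conditional prior is
        -- normalized; elsewhere `κ_n` vanishes.
        by_cases hζZ : ζ ∈ Z
        · exact mul_le_mul_left
            (h1 ζ hζZ (Metric.ball_subset_ball (min_le_left _ _) hζ)) _
        · simp [knotMarginal_eq_zero hπ₁ n hζZ]

end Mosaic

end BayesianMosaic

theorem corollary1
    -- the model, the true parameter and the sample
    {p d dη dζ : ℕ}
    (T : Set (EuclideanSpace ℝ (Fin d)))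
    (ν : Measure (EuclideanSpace ℝ (Fin p)))
    (f : EuclideanSpace ℝ (Fin d) → EuclideanSpace ℝ (Fin p) → ℝ)
    (hf : BayesianMosaic.DensityFamily p d T ν f)
    (θ₀ : EuclideanSpace ℝ (Fin d)) (hθ₀ : θ₀ ∈ interior T)
    {Ω : Type*} [MeasurableSpace Ω] (μ : Measure Ω) [IsProbabilityMeasure μ]
    (y : ℕ → Ω → EuclideanSpace ℝ (Fin p))
    (hy : BayesianMosaic.IsIIDSample μ (BayesianMosaic.dataLaw ν f θ₀) y)
    -- two non-overlapping sub-vectors of the parameter and their true values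
    (eη : Fin dη ↪ Fin d) (eζ : Fin dζ ↪ Fin d)
    (hdisj : Disjoint (Set.range eη) (Set.range eζ))
    (η₀ : EuclideanSpace ℝ (Fin dη)) (hη₀ : η₀ = BayesianMosaic.subvec eη θ₀)
    (ζ₀ : EuclideanSpace ℝ (Fin dζ)) (hζ₀ : ζ₀ = BayesianMosaic.subvec eζ θ₀)
    -- the two pseudo densities, defined at least for the sub-vectors of the parameters in `T`
    (Z : Set (EuclideanSpace ℝ (Fin dζ)))
    (hZ : ∀ θ ∈ T, BayesianMosaic.subvec eζ θ ∈ Z)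
    (f₁ : EuclideanSpace ℝ (Fin p) → EuclideanSpace ℝ (Fin dζ) → ℝ)
    (hf₁ : BayesianMosaic.IsPseudoDensity Z f₁)
    (W : Set (EuclideanSpace ℝ (Fin dη ⊕ Fin dζ)))
    (hW : ∀ θ ∈ T,
      BayesianMosaic.stack (BayesianMosaic.subvec eη θ) (BayesianMosaic.subvec eζ θ) ∈ W)
    (f₂ : EuclideanSpace ℝ (Fin p) → EuclideanSpace ℝ (Fin dη ⊕ Fin dζ) → ℝ)
    (hf₂ : BayesianMosaic.IsPseudoDensity W f₂)
    (hreg₁ : BayesianMosaic.RegularityConditions μ (BayesianMosaic.dataLaw ν f θ₀) y Z ζ₀ f₁)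
    (hreg₂ : BayesianMosaic.RegularityConditions μ (BayesianMosaic.dataLaw ν f θ₀) y W
      (BayesianMosaic.stack η₀ ζ₀) f₂)
    -- the priors
    (π₁ : EuclideanSpace ℝ (Fin dζ) → ℝ) (hπ₁ : BayesianMosaic.IsPriorDensity Z π₁)
    (hπ₁cont : ContinuousAt π₁ ζ₀) (hπ₁pos : 0 < π₁ ζ₀)
    (π₂ : EuclideanSpace ℝ (Fin dη) → EuclideanSpace ℝ (Fin dζ) → ℝ)
    (hπ₂ : BayesianMosaic.IsConditionalPriorDensity Z W π₂)
    (hπ₂cont : ContinuousAt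
      (fun q : EuclideanSpace ℝ (Fin dη) × EuclideanSpace ℝ (Fin dζ) => π₂ q.1 q.2) (η₀, ζ₀))
    (hπ₂pos : 0 < π₂ η₀ ζ₀) :
    BayesianMosaic.ConsistentAt μ (BayesianMosaic.mosaicPosterior f₁ π₁ f₂ π₂ y) (η₀, ζ₀) := by
  filter_upwards [hreg₁.ae_concentratesAt hy, hreg₂.ae_concentratesAt hy] with ω h₁ h₂ U hU
  exact BayesianMosaic.tendsto_mosaicPosterior hf₁ hπ₁ hf₂ hπ₂ hπ₁cont hπ₁pos hπ₂cont hπ₂pos h₁ h₂ hU
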